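/- Let $n\ge 2$. An $n$-Lie algebra is a finite-dimensional complex vector space $\mathfrak g$ with a skew-symmetric $n$-linear bracket satisfying $$[[x_1,\dots,x_n],y_2,\dots,y_n]=\sum_{i=1}^n[x_1,\dots,[x_i,y_2,\dots,y_n],\dots,x_n].$$ A metric on $\mathfrak g$ is a nondegenerate symmetric bilinear form $B$ with $$B([x_1,\dots,x_{n-1},y_1],y_2)=-B([x_1,\dots,x_{n-1},y_2],y_1),$$ and $(\mathfrak g,B)$ is then called a metric $n$-Lie algebra. A subspace $I\subseteq\mathfrak g$ is an ideal if $[I,\mathfrak g,\dots,\mathfrak g]\subseteq I$. Put $W^\perp=\{x\in\mathfrak g: B(w,x)=0\ \text{for all } w\in W\}$; a subspace $W$ is nondegenerate if $W\cap W^\perp=0$ and isotropic if $W\subseteq W^\perp$. The pair $(\mathfrak g,B)$ is indecomposable if $\mathfrak g$ is not the direct sum of two nonzero nondegenerate ideals. An ideal is isomaximal if it is isotropic and is not properly contained in any isotropic ideal. The center is $C(\mathfrak g)=\{x\in\mathfrak g:[x,\mathfrak g,\dots,\mathfrak g]=0\}$. Put $\mathfrak g^{(0)}=\mathfrak g$ and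 $\mathfrak g^{(s+1)}=[\mathfrak g^{(s)},\dots,\mathfrak g^{(s)}]$ (the linear span of all brackets of $n$ elements of $\mathfrak g^{(s)}$) for $s\ge 0$; $\mathfrak g$ is solvable if $\mathfrak g^{(r)}=0$ for some $r\ge 0$. Let $(\mathfrak g,B)$ be an indecomposable metric $n$-Lie algebra whose center $C(\mathfrak g)$ is nonzero and is an isomaximal ideal. Then $\mathfrak g$ is solvable. -/

import Mathlib

/-- An `n`-Lie algebra structure (Filippov) on a complex vector space `g`. Skew-symmetry
(`[x₁, …, xₙ] = sign σ • [x_{σ 1}, …, x_{σ n}]`, which over `ℂ` is the same as being alternating)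
is contained in the type of `bracket`.
The fundamental identity
`[[x₁, …, xₙ], y₂, …, yₙ] = ∑ i, [x₁, …, [xᵢ, y₂, …, yₙ], …, xₙ]`
is stated with the distinguished slot `j` arbitrary instead of the first one: exchanging slot `j`
and the first slot changes the sign of both sides. The entry `y j` is overwritten. -/
structure NLieAlgebra (n : ℕ) (g : Type*) [AddCommGroup g] [Module ℂ g] where
  /-- The `n`-ary bracket `[x₁, …, xₙ]`. -/
  bracket : g [⋀^Fin n]→ₗ[ℂ] g
  fundamental_identity : ∀ (x y : Fin n → g) (j : Fin n),
    bracket (Function.update y j (bracket x)) =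
      ∑ i, bracket (Function.update x i (bracket (Function.update y j (x i))))

namespace NLieAlgebra

variable {n : ℕ} {g : Type*} [AddCommGroup g] [Module ℂ g]

/-- `I` is an ideal: `[I, g, …, g] ⊆ I` (by skew-symmetry the slot is immaterial). -/
def IsIdeal (L : NLieAlgebra n g) (I : Submodule ℂ g) : Prop :=
  ∀ (v : Fin n → g) (i : Fin n), v i ∈ I → L.bracket v ∈ I

/-- The center `{x | [x, g, …, g] = 0}` (by skew-symmetry the slot is immaterial). -/
def center (L : NLieAlgebra n g) : Submodule ℂ g where
  carrier := {x | ∀ (v : Fin n → g) (i : Fin n), L.bracket (Function.update v i x) = 0}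
  zero_mem' := fun v i => L.bracket.map_update_zero v i
  add_mem' := fun {a b} ha hb v i => by
    rw [L.bracket.map_update_add, ha v i, hb v i, add_zero]
  smul_mem' := fun c x hx v i => by
    rw [L.bracket.map_update_smul, hx v i, smul_zero]

/-- The subspace `[W, …, W]` spanned by all brackets of `n` elements of `W`. -/
def bracketSpan (L : NLieAlgebra n g) (W : Submodule ℂ g) : Submodule ℂ g :=
  Submodule.span ℂ {z | ∃ v : Fin n → g, (∀ i, v i ∈ W) ∧ L.bracket v = z}

/-- The derived series `I⁽⁰⁾ = I`, `I⁽ˢ⁺¹⁾ = [I⁽ˢ⁾, …, I⁽ˢ⁾]`. -/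
def derivedSeries (L : NLieAlgebra n g) (I : Submodule ℂ g) : ℕ → Submodule ℂ g
  | 0 => I
  | s + 1 => L.bracketSpan (L.derivedSeries I s)

/-- `I` is a solvable ideal. -/
def IsSolvableIdeal (L : NLieAlgebra n g) (I : Submodule ℂ g) : Prop :=
  L.IsIdeal I ∧ ∃ r : ℕ, L.derivedSeries I r = ⊥

/-- The `n`-Lie algebra is solvable, that is, `g` is a solvable ideal of itself. -/
def IsSolvable (L : NLieAlgebra n g) : Prop :=
  L.IsSolvableIdeal ⊤

end NLieAlgebra

/-- A metric `n`-Lie algebra: an `n`-Lie algebra with a nondegenerate symmetric bilinear form `B`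
such that `B ([x₁, …, xₙ₋₁, y₁], y₂) = - B ([x₁, …, xₙ₋₁, y₂], y₁)`. The invariance is stated with
the varying slot `i` arbitrary instead of the last one, which is equivalent by skew-symmetry;
the entry `x i` is overwritten. -/
structure MetricNLieAlgebra (n : ℕ) (g : Type*) [AddCommGroup g] [Module ℂ g] extends
    NLieAlgebra n g where
  /-- The metric. -/
  B : LinearMap.BilinForm ℂ g
  symm : ∀ x y, B x y = B y x
  nondegenerate : ∀ x, (∀ y, B x y = 0) → x = 0
  invariant : ∀ (x : Fin n → g) (i : Fin n) (y₁ y₂ : g),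
    B (bracket (Function.update x i y₁)) y₂ = -B (bracket (Function.update x i y₂)) y₁

namespace MetricNLieAlgebra

variable {n : ℕ} {g : Type*} [AddCommGroup g] [Module ℂ g]

/-- The orthogonal complement `{x | B w x = 0 for all w ∈ W}`. -/
def orthogonal (M : MetricNLieAlgebra n g) (W : Submodule ℂ g) : Submodule ℂ g :=
  LinearMap.BilinForm.orthogonal M.B W

/-- `W` is nondegenerate: `W ∩ W^⊥ = 0`. -/
def IsNondegenerate (M : MetricNLieAlgebra n g) (W : Submodule ℂ g) : Prop :=
  W ⊓ M.orthogonal W = ⊥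

/-- `W` is isotropic: `W ⊆ W^⊥`. -/
def IsIsotropic (M : MetricNLieAlgebra n g) (W : Submodule ℂ g) : Prop :=
  W ≤ M.orthogonal W

/-- `I` is an isotropic ideal. -/
def IsIsotropicIdeal (M : MetricNLieAlgebra n g) (I : Submodule ℂ g) : Prop :=
  M.IsIdeal I ∧ M.IsIsotropic I

/-- `I` is an isomaximal ideal: an isotropic ideal that is not properly contained in any
isotropic ideal. -/
def IsIsomaximal (M : MetricNLieAlgebra n g) (I : Submodule ℂ g) : Prop :=
  Maximal M.IsIsotropicIdeal I

/-- The metric `n`-Lie algebra is the direct sum of two nonzero nondegenerate ideals. -/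
def IsDecomposable (M : MetricNLieAlgebra n g) : Prop :=
  ∃ I J : Submodule ℂ g, M.IsIdeal I ∧ M.IsIdeal J ∧ M.IsNondegenerate I ∧ M.IsNondegenerate J ∧
    I ≠ ⊥ ∧ J ≠ ⊥ ∧ IsCompl I J

/-- Not decomposable. -/
def IsIndecomposable (M : MetricNLieAlgebra n g) : Prop :=
  ¬M.IsDecomposable

end MetricNLieAlgebra

-- The derived series stabilizes at an ideal P with [P, …, P] = P; the claim is P = 0
-- (`eq_bot_of_perfect`). Let Z be the center and N = P ∩ Z. Invariance puts P inside Z^⊥, so by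
-- isomaximality every isotropic ideal inside P lies in N (`le_center_of_isotropic`).
--
-- Suppose P ≠ 0 and let D be the Lie algebra of skew derivations of P vanishing on N. The radical R
-- of its trace form on P is solvable by Cartan's criterion, and Lie's theorem shows that [D, R]
-- sends P into N (`lie_lie_mem_of_isSolvable`). As P is perfect, a derivation with central values
-- is zero, and so is one commuting with the inner derivations; hence [D, R] = 0, then R = 0.
--
-- So D has a Casimir operator on P. It kills N and has trace dim D ≠ 0, so its Fitting
-- decomposition yields a D-stable J ≠ 0 with J ∩ N = 0. D contains the action of all of g on P, so
-- J is an ideal of g; J ∩ J^⊥ is isotropic, hence in N, hence 0. Indecomposability forces J = g,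
-- against Z ≠ 0.

attribute [local instance] LieRing.ofAssociativeRing

/-! ### Lie modules: Cartan's criterion, the Casimir operator, trace forms -/

namespace LieModule

open Module

section

variable {K L V : Type*} [Field K] [CharZero K] [LieRing L] [LieAlgebra K L]
  [AddCommGroup V] [Module K V] [LieRingModule L V] [LieModule K L V]

/-- Cartan's criterion: [L, L] acts nilpotently on V, hence by faithfulness ad-nilpotently on
itself, and Engel's theorem makes it nilpotent. -/
lemma isSolvable_of_traceForm_eq_zero [Module.Finite K L] [Module.Finite K V]
    (hinj : Function.Injective (toEnd K L V)) (h : traceForm K L V = 0) :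
    LieAlgebra.IsSolvable L := by
  have hnil := isNilpotent_derivedSeries_of_traceForm_eq_zero h
  set D := LieAlgebra.derivedSeries K L 1
  have : LieRing.IsNilpotent D := by
    rw [LieAlgebra.isNilpotent_iff_forall (R := K)]
    intro d
    apply LieSubalgebra.isNilpotent_ad_of_isNilpotent_ad (D : LieSubalgebra K L) (x := d)
    obtain ⟨k, hk⟩ := LieAlgebra.ad_nilpotent_of_nilpotent (R := K)
      ((isNilpotent_iff_forall' (R := K)).mp hnil d)
    refine ⟨k, LinearMap.ext fun y ↦ hinj ?_⟩
    -- The faithful representation intertwines ad on L with ad on End V, where nilpotency of `d`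
    -- passes to its ad.
    have key : ∀ (m : ℕ) (y : L), toEnd K L V ((LieAlgebra.ad K L (d : L) ^ m) y) =
        (LieAlgebra.ad K (Module.End K V) (toEnd K D V d) ^ m) (toEnd K L V y) := by
      intro m
      induction m with
      | zero => simp
      | succ m ih =>
        intro y
        rw [pow_succ, Module.End.mul_apply, ih, pow_succ, Module.End.mul_apply,
          LieAlgebra.ad_apply, LieHom.map_lie]
        rfl
    rw [key, hk]
    simp
  obtain ⟨k, hk⟩ := LieAlgebra.IsSolvable.solvable K D
  rw [LieIdeal.derivedSeries_eq_bot_iff] at hk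
  refine LieAlgebra.IsSolvable.mk (R := K) (k := k + 1) ?_
  rwa [LieAlgebra.derivedSeries_def, LieAlgebra.derivedSeriesOfIdeal_add]

end

section

variable {K L V : Type*} [Field K] [LieRing L] [LieAlgebra K L]
  [AddCommGroup V] [Module K V] [LieRingModule L V] [LieModule K L V]

variable (K L V) in
-- C = ∑ bᵢ b'ᵢ for trace-dual bases; invariance of the trace form makes it commute with L.
lemma exists_casimir [Module.Finite K L] (hnd : (traceForm K L V).Nondegenerate) :
    ∃ C : Module.End K V, LinearMap.trace K V C = finrank K L ∧
      (∀ v, (∀ x : L, ⁅x, v⁆ = 0) → C v = 0) ∧ ∀ (x : L) v, C ⁅x, v⁆ = ⁅x, C v⁆ := by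
  let b := finBasis K L
  let b' := LinearMap.BilinForm.dualBasis (traceForm K L V) hnd b
  have hr : ∀ i j, traceForm K L V (b i) (b' j) = if i = j then 1 else 0 :=
    LinearMap.BilinForm.apply_dualBasis_right hnd ⟨traceForm_comm K L V⟩ b
  have eb : ∀ x : L, x = ∑ j, traceForm K L V x (b' j) • b j := by
    intro x
    conv_lhs => rw [← b.sum_repr x]
    refine Finset.sum_congr rfl fun j _ ↦ ?_
    congr 1
    conv_rhs => rw [← b.sum_repr x]
    simp [hr, -Basis.sum_repr]
  have eb' : ∀ x : L, x = ∑ j, traceForm K L V x (b j) • b' j := by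
    intro x
    conv_lhs => rw [← b'.sum_repr x]
    refine Finset.sum_congr rfl fun j _ ↦ ?_
    rw [LinearMap.BilinForm.dualBasis_repr_apply]
  refine ⟨∑ i, toEnd K L V (b i) ∘ₗ toEnd K L V (b' i), ?_, ?_, ?_⟩
  · simp only [map_sum, ← traceForm_apply_apply, hr]
    simp
  · intro v hv
    simp [hv]
  · intro x v
    rw [← sub_eq_zero]
    simp only [LinearMap.sum_apply, LinearMap.comp_apply, toEnd_apply_apply, lie_sum,
      ← Finset.sum_sub_distrib]
    have h1 : ∀ i, ⁅b i, ⁅b' i, ⁅x, v⁆⁆⁆ - ⁅x, ⁅b i, ⁅b' i, v⁆⁆⁆ =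
        -(⁅⁅x, b i⁆, ⁅b' i, v⁆⁆ + ⁅b i, ⁅⁅x, b' i⁆, v⁆⁆) := by
      intro i
      simp only [lie_lie, lie_sub]
      abel
    have h2 : ∀ i, ⁅⁅x, b i⁆, ⁅b' i, v⁆⁆ =
        ∑ j, traceForm K L V ⁅x, b i⁆ (b' j) • ⁅b j, ⁅b' i, v⁆⁆ := by
      intro i
      conv_lhs => rw [eb ⁅x, b i⁆]
      simp [sum_lie]
    have h3 : ∀ i, ⁅b i, ⁅⁅x, b' i⁆, v⁆⁆ =
        ∑ j, traceForm K L V ⁅x, b' i⁆ (b j) • ⁅b i, ⁅b' j, v⁆⁆ := by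
      intro i
      conv_lhs => rw [eb' ⁅x, b' i⁆]
      simp [sum_lie, lie_sum]
    simp only [h1, Finset.sum_neg_distrib, Finset.sum_add_distrib, h2, h3]
    rw [Finset.sum_comm, ← Finset.sum_add_distrib]
    simp only [← Finset.sum_add_distrib, ← add_smul]
    rw [neg_eq_zero]
    refine Finset.sum_eq_zero fun i _ ↦ Finset.sum_eq_zero fun j _ ↦ ?_
    rw [traceForm_apply_lie_apply' K L V x (b j), traceForm_comm K L V (b j), neg_add_cancel,
      zero_smul]

variable (N : LieSubmodule K L V) (b : LinearMap.BilinForm K V)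

/-- The vectors sent into `N` by `⁅L, A⁆`. -/
def lieIdealPreimage (A : LieIdeal K L) : LieSubmodule K L V where
  carrier := {v | ∀ (x : L), ∀ a ∈ A, ⁅⁅x, a⁆, v⁆ ∈ N}
  zero_mem' := by simp
  add_mem' := fun {v w} hv hw x a ha ↦ by
    rw [lie_add]; exact add_mem (hv x a ha) (hw x a ha)
  smul_mem' := fun c v hv x a ha ↦ by
    rw [lie_smul]; exact N.smul_mem c (hv x a ha)
  lie_mem := fun {y v} hv x a ha ↦ by
    have h : ⁅⁅x, a⁆, ⁅y, v⁆⁆ = ⁅y, ⁅⁅x, a⁆, v⁆⁆ - (⁅⁅⁅y, x⁆, a⁆, v⁆ + ⁅⁅x, ⁅y, a⁆⁆, v⁆) := by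
      rw [leibniz_lie y ⁅x, a⁆ v, leibniz_lie y x a, add_lie]
      abel
    rw [h]
    exact sub_mem (N.lie_mem (hv x a ha))
      (add_mem (hv _ a ha) (hv x _ (lie_mem_right K L A y a ha)))

/-- The right orthogonal of a Lie submodule with respect to an invariant form. -/
def orthogonalOfSkew (hskew : ∀ (x : L) v w, b ⁅x, v⁆ w = -b v ⁅x, w⁆)
    (I : LieSubmodule K L V) : LieSubmodule K L V where
  __ := b.orthogonal I
  lie_mem := fun {y v} hv w hw ↦ by
    have := hskew y w v
    rw [hv _ (I.lie_mem hw)] at this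
    simpa only [neg_zero, zero_eq_neg, LinearMap.map_neg] using this

/-- If the isotropic submodules lie in `N`, then `⁅L, A⁆` sends `V` into `N` for every solvable
ideal `A`. -/
lemma lie_lie_mem_of_isSolvable [IsAlgClosed K] [CharZero K] [Module.Finite K V]
    (hskew : ∀ (x : L) v w, b ⁅x, v⁆ w = -b v ⁅x, w⁆)
    (hNb : ∀ z ∈ N, ∀ v, b z v = 0)
    (hiso : ∀ I : LieSubmodule K L V, (∀ v ∈ I, ∀ w ∈ I, b v w = 0) → I ≤ N)
    (A : LieIdeal K L) [LieAlgebra.IsSolvable A] (x : L) {a : L} (ha : a ∈ A) (v : V) :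
    ⁅⁅x, a⁆, v⁆ ∈ N := by
  set I₀ := lieIdealPreimage N A
  set I₁ := orthogonalOfSkew b hskew I₀
  -- By skewness [L, A]V is orthogonal to `I₀`, since [L, A] sends `I₀` into the radical part `N`.
  have hEI : ⁅⁅x, a⁆, v⁆ ∈ I₁ := by
    intro w hw
    have := hskew ⁅x, a⁆ w v
    rw [hNb _ (hw x a ha)] at this
    simpa only [neg_zero, zero_eq_neg, LinearMap.map_neg] using this
  have hI : I₀ ⊓ I₁ ≤ N := hiso _ fun v hv w hw ↦ hw.2 v hv.1
  suffices I₁ ≤ N from this hEI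
  by_contra hnot
  obtain ⟨p, hp, hpN⟩ := SetLike.not_le_iff_exists.mp hnot
  let W : LieSubmodule K L (V ⧸ N) := I₁.map (LieSubmodule.Quotient.mk' N)
  have hmk : ∀ q : V, LieSubmodule.Quotient.mk' N q = 0 ↔ q ∈ N := fun q ↦
    LieSubmodule.Quotient.mk_eq_zero N
  have hpW : LieSubmodule.Quotient.mk' N p ∈ W := LieSubmodule.mem_map_of_mem hp
  have : Nontrivial W :=
    nontrivial_of_ne ⟨_, hpW⟩ 0 fun h ↦ hpN ((hmk p).mp (congrArg Subtype.val h))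
  -- Lie's theorem on the image of `I₁` in V/N. The weight space is L-stable, so `A` acts on q and
  -- on each yq by the same scalars; thus [L, A]q lies in `N` and q in I₀ ∩ I₁ ≤ N.
  obtain ⟨χ, hχ⟩ := exists_nontrivial_weightSpace_of_isSolvable K A W
  obtain ⟨⟨⟨w, hw⟩, hwχ⟩, hw0⟩ := exists_ne (0 : weightSpace W χ)
  have hU : ∀ y : L, ⁅y, (⟨w, hw⟩ : W)⁆ ∈ weightSpaceOfIsLieTower K W χ := fun y ↦
    (weightSpaceOfIsLieTower K W χ).lie_mem hwχ
  obtain ⟨q, hq, rfl⟩ := (LieSubmodule.mem_map _).mp hw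
  have hqN : q ∉ N := fun h ↦ hw0 (by
    ext; exact (hmk q).mpr h)
  refine hqN (hI ⟨fun y a ha ↦ ?_, hq⟩)
  rw [← hmk, LieModuleHom.map_lie]
  have h1 := (mem_weightSpace χ _).mp hwχ ⟨a, ha⟩
  have h2 := (mem_weightSpace χ _).mp (hU y) ⟨a, ha⟩
  replace h1 : ⁅a, LieSubmodule.Quotient.mk' N q⁆ = χ ⟨a, ha⟩ • LieSubmodule.Quotient.mk' N q :=
    congrArg Subtype.val h1
  replace h2 : ⁅a, ⁅y, LieSubmodule.Quotient.mk' N q⁆⁆ =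
      χ ⟨a, ha⟩ • ⁅y, LieSubmodule.Quotient.mk' N q⁆ := congrArg Subtype.val h2
  rw [lie_lie, h1, h2, lie_smul, sub_self]

/-- If the isotropic submodules lie in `N`, then the trace form is nondegenerate. -/
lemma traceForm_nondegenerate_of_isotropic_le [IsAlgClosed K] [CharZero K] [Module.Finite K L]
    [Module.Finite K V]
    (hskew : ∀ (x : L) v w, b ⁅x, v⁆ w = -b v ⁅x, w⁆)
    (hNb : ∀ z ∈ N, ∀ v, b z v = 0)
    (hiso : ∀ I : LieSubmodule K L V, (∀ v ∈ I, ∀ w ∈ I, b v w = 0) → I ≤ N)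
    (hfaith : ∀ x : L, (∀ v : V, ⁅x, v⁆ ∈ N) → x = 0)
    (hcenter : ∀ x : L, (∀ y : L, ⁅y, x⁆ = 0) → x = 0) :
    (traceForm K L V).Nondegenerate := by
  let R : LieIdeal K L :=
    { LinearMap.ker (traceForm K L V) with
      lie_mem := fun {y x} hx ↦ by
        ext z
        have hx' : traceForm K L V x = 0 := hx
        rw [traceForm_apply_lie_apply', hx']
        simp }
  have hR : ∀ x ∈ R, ∀ y, traceForm K L V x y = 0 := fun x hx y ↦ by
    have hx' : traceForm K L V x = 0 := hx
    rw [hx']; rfl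
  have : LieAlgebra.IsSolvable R := by
    refine isSolvable_of_traceForm_eq_zero (K := K) (V := V) ?_ ?_
    · rw [← LieHom.coe_toLinearMap, ← LinearMap.ker_eq_bot, LinearMap.ker_eq_bot']
      intro x hx
      refine Subtype.ext (hfaith x fun v ↦ ?_)
      have : ⁅x, v⁆ = 0 := LinearMap.congr_fun hx v
      exact (congrArg (· ∈ N) this).mpr N.zero_mem
    · ext x y
      exact hR x x.2 y
  have hbot : LinearMap.ker (traceForm K L V) = ⊥ := by
    rw [eq_bot_iff]
    -- [L, R] sends V into `N`, so it vanishes by `hfaith`; the radical is then central, hence zero.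
    intro x hx
    refine hcenter x fun y ↦ hfaith _ fun v ↦ ?_
    exact lie_lie_mem_of_isSolvable N b hskew hNb hiso R y hx v
  exact (traceForm_isSymm K L V).isRefl.nondegenerate_iff_separatingLeft.mpr
    (LinearMap.separatingLeft_iff_ker_eq_bot.mpr hbot)

lemma exists_ne_bot_disjoint_of_traceForm_nondegenerate [CharZero K] [Module.Finite K L]
    [Module.Finite K V] [Nontrivial L]
    (hnd : (traceForm K L V).Nondegenerate) (hN : ∀ (x : L), ∀ z ∈ N, ⁅x, z⁆ = 0) :
    ∃ J : LieSubmodule K L V, J ≠ ⊥ ∧ Disjoint (J : Submodule K V) N := by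
  obtain ⟨C, htr, hC0, hC⟩ := exists_casimir K L V hnd
  -- Fitting decomposition of C; k ≥ 1 ensures that `C ^ k` still kills `N`.
  obtain ⟨k, hk, hk1⟩ := ((LinearMap.eventually_isCompl_ker_pow_range_pow C).and
    (Filter.eventually_ge_atTop 1)).exists
  have hCk : ∀ (m : ℕ) (x : L) v, (C ^ m) ⁅x, v⁆ = ⁅x, (C ^ m) v⁆ := by
    intro m
    induction m with
    | zero => simp
    | succ m ih => intro x v; rw [pow_succ', Module.End.mul_apply, ih, hC]; rfl
  let J : LieSubmodule K L V :=
    { LinearMap.range (C ^ k) with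
      lie_mem := by
        rintro x _ ⟨v, rfl⟩
        exact ⟨⁅x, v⁆, hCk k x v⟩ }
  refine ⟨J, fun h ↦ ?_, ?_⟩
  · have h0 : C ^ k = 0 := by
      ext v
      have : (C ^ k) v ∈ J := ⟨v, rfl⟩
      simpa [h] using this
    have := (LinearMap.isNilpotent_trace_of_isNilpotent ⟨k, h0⟩ : _root_.IsNilpotent
      (LinearMap.trace K V C)).eq_zero
    rw [htr] at this
    exact (finrank_pos (R := K) (M := L)).ne' (by exact_mod_cast this)
  · refine hk.disjoint.symm.mono_right fun z hz ↦ ?_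
    obtain ⟨m, rfl⟩ := Nat.exists_eq_add_of_le' hk1
    rw [LinearMap.mem_ker, pow_succ, Module.End.mul_apply, hC0 z fun x ↦ hN x z hz, map_zero]

end

end LieModule

/-! ### Derivations and ideals of n-Lie algebras -/

namespace NLieAlgebra

variable {n : ℕ} {g : Type*} [AddCommGroup g] [Module ℂ g]

/-- The inner derivation `w ↦ [v₁, …, w, …, vₙ]` with `w` in slot `i`. -/
def ad (L : NLieAlgebra n g) (v : Fin n → g) (i : Fin n) : Module.End ℂ g :=
  L.bracket.toMultilinearMap.toLinearMap v i

@[simp]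
lemma ad_apply (L : NLieAlgebra n g) (v : Fin n → g) (i : Fin n) (w : g) :
    L.ad v i w = L.bracket (Function.update v i w) := rfl

/-- `f` is a derivation of the `n`-ary bracket. -/
def IsDerivation (L : NLieAlgebra n g) (f : Module.End ℂ g) : Prop :=
  ∀ v : Fin n → g, f (L.bracket v) = ∑ i, L.bracket (Function.update v i (f (v i)))

lemma isDerivation_ad (L : NLieAlgebra n g) (v : Fin n → g) (i : Fin n) :
    L.IsDerivation (L.ad v i) := fun x ↦ L.fundamental_identity x v i

lemma IsDerivation.lie {L : NLieAlgebra n g} {f h : Module.End ℂ g} (hf : L.IsDerivation f)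
    (hh : L.IsDerivation h) : L.IsDerivation ⁅f, h⁆ := by
  intro v
  have key : ∀ a c : Module.End ℂ g, L.IsDerivation a → L.IsDerivation c →
      a (c (L.bracket v)) = ∑ i, ∑ j, L.bracket (Function.update
        (Function.update v i (c (v i))) j (a (Function.update v i (c (v i)) j))) := by
    intro a c ha hc
    rw [hc, map_sum]
    exact Finset.sum_congr rfl fun i _ ↦ ha _
  rw [Ring.lie_def, LinearMap.sub_apply, Module.End.mul_apply, Module.End.mul_apply,
    key f h hf hh, key h f hh hf]
  -- After the swap, terms with f and h in different slots cancel; only the diagonal survives.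
  conv_lhs => arg 2; rw [Finset.sum_comm]
  rw [← Finset.sum_sub_distrib]
  refine Finset.sum_congr rfl fun i _ ↦ ?_
  rw [← Finset.sum_sub_distrib, Finset.sum_eq_single i]
  · simp [L.bracket.map_update_sub]
  · intro j _ hji
    rw [Function.update_of_ne hji, Function.update_of_ne hji.symm, Function.update_comm hji.symm,
      sub_self]
  · simp

/-- The derivations that are skew with respect to `b` and vanish on `N`. -/
def skewDerivations (L : NLieAlgebra n g) (b : LinearMap.BilinForm ℂ g) (N : Submodule ℂ g) :
    LieSubalgebra ℂ (Module.End ℂ g) where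
  carrier := {f | L.IsDerivation f ∧ (∀ v w, b (f v) w = -b v (f w)) ∧ ∀ z ∈ N, f z = 0}
  zero_mem' := ⟨fun v ↦ by simp [L.bracket.map_update_zero], by simp, by simp⟩
  add_mem' := fun {f h} hf hh ↦
    ⟨fun v ↦ by simp [hf.1 v, hh.1 v, L.bracket.map_update_add, Finset.sum_add_distrib],
      fun v w ↦ by simp [hf.2.1, hh.2.1, add_comm],
      fun z hz ↦ by simp [hf.2.2 z hz, hh.2.2 z hz]⟩
  smul_mem' := fun c f hf ↦
    ⟨fun v ↦ by simp [hf.1 v, L.bracket.map_update_smul, Finset.smul_sum],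
      fun v w ↦ by simp [hf.2.1], fun z hz ↦ by simp [hf.2.2 z hz]⟩
  lie_mem' := fun {f h} hf hh ↦
    ⟨hf.1.lie hh.1,
      fun v w ↦ by simp [Ring.lie_def, hf.2.1, hh.2.1],
      fun z hz ↦ by simp [Ring.lie_def, hf.2.2 z hz, hh.2.2 z hz]⟩

lemma linearMap_eq_zero_of_perfect {L : NLieAlgebra n g} (hL : L.bracketSpan ⊤ = ⊤)
    {f : Module.End ℂ g} (hf : ∀ v, f (L.bracket v) = 0) : f = 0 := by
  rw [← LinearMap.ker_eq_top, eq_top_iff, ← hL, bracketSpan, Submodule.span_le]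
  rintro _ ⟨v, -, rfl⟩
  exact hf v

lemma IsDerivation.eq_zero_of_mem_center {L : NLieAlgebra n g} (hL : L.bracketSpan ⊤ = ⊤)
    {f : Module.End ℂ g} (hf : L.IsDerivation f) (hc : ∀ v, f v ∈ L.center) : f = 0 :=
  linearMap_eq_zero_of_perfect hL fun v ↦ by
    rw [hf]
    exact Finset.sum_eq_zero fun i _ ↦ hc (v i) v i

/-- Each of the n Leibniz terms equals f[v], so f[v] = n f[v] with n ≠ 1. -/
lemma IsDerivation.eq_zero_of_commute_ad {L : NLieAlgebra n g} (hn : 2 ≤ n)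
    (hL : L.bracketSpan ⊤ = ⊤) {f : Module.End ℂ g} (hf : L.IsDerivation f)
    (hc : ∀ v i w, f (L.ad v i w) = L.ad v i (f w)) : f = 0 :=
  linearMap_eq_zero_of_perfect hL fun v ↦ by
    have h1 : f (L.bracket v) = (n : ℂ) • f (L.bracket v) := by
      conv_lhs => rw [hf]
      rw [Finset.sum_congr rfl fun i _ ↦ show _ = f (L.bracket v) by
        have := hc v i (v i)
        rw [ad_apply, Function.update_eq_self] at this
        exact this.symm]
      simp [Nat.cast_smul_eq_nsmul]
    have h2 : ((n : ℂ) - 1) • f (L.bracket v) = 0 := by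
      rw [sub_smul, ← h1, one_smul, sub_self]
    refine (smul_eq_zero.mp h2).resolve_left fun h ↦ ?_
    have : n = 1 := by exact_mod_cast sub_eq_zero.mp h
    lia

/-- In a perfect `n`-Lie algebra whose isotropic invariant subspaces lie in a central subspace `N`,
some nonzero invariant subspace meets `N` trivially. -/
lemma exists_invariant_disjoint [FiniteDimensional ℂ g] [Nontrivial g] {L : NLieAlgebra n g}
    (hn : 2 ≤ n) (hL : L.bracketSpan ⊤ = ⊤) {b : LinearMap.BilinForm ℂ g} {N : Submodule ℂ g}
    (had : ∀ v i x y, b (L.ad v i x) y = -b x (L.ad v i y)) (hN : N ≤ L.center)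
    (hNb : ∀ z ∈ N, ∀ v, b z v = 0)
    (hiso : ∀ I : Submodule ℂ g, (∀ f ∈ L.skewDerivations b N, ∀ x ∈ I, f x ∈ I) →
      (∀ v ∈ I, ∀ w ∈ I, b v w = 0) → I ≤ N) :
    ∃ J : Submodule ℂ g, (∀ f ∈ L.skewDerivations b N, ∀ x ∈ J, f x ∈ J) ∧ J ≠ ⊥ ∧
      Disjoint J N := by
  set D := L.skewDerivations b N
  have hadD : ∀ v i, L.ad v i ∈ D := fun v i ↦
    ⟨L.isDerivation_ad v i, had v i, fun z hz ↦ hN hz v i⟩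
  have hlie : ∀ (x : D) (v : g), ⁅x, v⁆ = (x : Module.End ℂ g) v := fun _ _ ↦ rfl
  let N' : LieSubmodule ℂ D g :=
    { N with
      lie_mem := fun {x z} hz ↦ by
        rw [hlie, x.2.2.2 z hz]
        exact N.zero_mem }
  have : Nontrivial D := by
    by_contra hsub
    rw [not_nontrivial_iff_subsingleton] at hsub
    -- If D = 0, all brackets vanish, which perfectness forbids.
    have h0 : (LinearMap.id : Module.End ℂ g) = 0 := linearMap_eq_zero_of_perfect hL fun v ↦ by
      have i : Fin n := ⟨0, by lia⟩
      have := congrArg (fun x : D ↦ (x : Module.End ℂ g) (v i))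
        (Subsingleton.elim (⟨_, hadD v i⟩ : D) 0)
      simpa using this
    obtain ⟨x, hx⟩ := exists_ne (0 : g)
    exact hx (LinearMap.congr_fun h0 x)
  have hnd := LieModule.traceForm_nondegenerate_of_isotropic_le N' b
    (fun x v w ↦ x.2.2.1 v w) hNb
    (fun I hI ↦ hiso I (fun f hf x hx ↦ I.lie_mem (x := ⟨f, hf⟩) hx) hI)
    (fun x hx ↦ Subtype.ext (x.2.1.eq_zero_of_mem_center hL fun v ↦ hN (hx v)))
    (fun x hx ↦ Subtype.ext (x.2.1.eq_zero_of_commute_ad hn hL fun v i w ↦ by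
      have := congrArg (fun y : D ↦ (y : Module.End ℂ g) w) (hx ⟨_, hadD v i⟩)
      exact (sub_eq_zero.mp this).symm))
  obtain ⟨J, hJ, hJN⟩ := LieModule.exists_ne_bot_disjoint_of_traceForm_nondegenerate N' hnd
    (fun x z hz ↦ x.2.2.2 z hz)
  exact ⟨J, fun f hf x hx ↦ J.lie_mem (x := ⟨f, hf⟩) hx, by simpa using hJ, hJN⟩

lemma coe_update {I : Submodule ℂ g} (v : Fin n → I) (i : Fin n) (w : I) :
    (fun k ↦ ((Function.update v i w k : I) : g)) = Function.update (fun k ↦ (v k : g)) i w := by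
  ext k
  by_cases hk : k = i
  · subst hk; simp
  · simp [hk]

/-- An ideal as an `n`-Lie algebra. -/
def restrict (L : NLieAlgebra n g) (hn : 0 < n) {I : Submodule ℂ g} (hI : L.IsIdeal I) :
    NLieAlgebra n I where
  bracket := (L.bracket.compLinearMap I.subtype).codRestrict I fun v ↦ hI _ ⟨0, hn⟩ (v _).2
  fundamental_identity x y j := by
    have hb : ∀ v : Fin n → I, (((L.bracket.compLinearMap I.subtype).codRestrict I
        fun v ↦ hI _ ⟨0, hn⟩ (v _).2) v : g) = L.bracket fun k ↦ (v k : g) := fun _ ↦ rfl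
    refine Subtype.ext ?_
    rw [AddSubmonoidClass.coe_finsetSum]
    simp only [hb, coe_update]
    exact L.fundamental_identity (fun k ↦ (x k : g)) (fun k ↦ (y k : g)) j

lemma IsIdeal.ad_mem {L : NLieAlgebra n g} {I : Submodule ℂ g} (hI : L.IsIdeal I) (v : Fin n → g)
    (i : Fin n) {x : g} (hx : x ∈ I) : L.ad v i x ∈ I :=
  hI _ i (by simpa using hx)

lemma isIdeal_of_ad {L : NLieAlgebra n g} {I : Submodule ℂ g}
    (h : ∀ v i, ∀ x ∈ I, L.ad v i x ∈ I) : L.IsIdeal I := fun v i hv ↦ by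
  simpa using h v i _ hv

lemma IsIdeal.bracketSpan {L : NLieAlgebra n g} {I : Submodule ℂ g} (hI : L.IsIdeal I) :
    L.IsIdeal (L.bracketSpan I) := by
  refine isIdeal_of_ad fun v i x hx ↦ ?_
  revert x
  change L.bracketSpan I ≤ (L.bracketSpan I).comap (L.ad v i)
  conv_lhs => rw [NLieAlgebra.bracketSpan]
  rw [Submodule.span_le]
  rintro _ ⟨x, hx, rfl⟩
  refine (congrArg (· ∈ L.bracketSpan I) (L.isDerivation_ad v i x)).mpr ?_
  refine Submodule.sum_mem _ fun k _ ↦ Submodule.subset_span ⟨_, fun m ↦ ?_, rfl⟩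
  by_cases hm : m = k
  · subst hm; simpa using hI.ad_mem v i (hx m)
  · simpa [hm] using hx m

lemma IsIdeal.bracketSpan_le {L : NLieAlgebra n g} (hn : 0 < n) {I : Submodule ℂ g}
    (hI : L.IsIdeal I) : L.bracketSpan I ≤ I :=
  Submodule.span_le.mpr (by rintro _ ⟨v, hv, rfl⟩; exact hI v ⟨0, hn⟩ (hv _))

lemma isIdeal_center (L : NLieAlgebra n g) : L.IsIdeal L.center :=
  isIdeal_of_ad fun v i x hx ↦ by
    rw [ad_apply, hx v i]; exact zero_mem _

lemma IsIdeal.sup {L : NLieAlgebra n g} {I J : Submodule ℂ g} (hI : L.IsIdeal I)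
    (hJ : L.IsIdeal J) : L.IsIdeal (I ⊔ J) := by
  refine isIdeal_of_ad fun v i x hx ↦ ?_
  obtain ⟨a, ha, c, hc, rfl⟩ := Submodule.mem_sup.mp hx
  rw [map_add]
  exact Submodule.add_mem_sup (hI.ad_mem v i ha) (hJ.ad_mem v i hc)

lemma IsIdeal.inf {L : NLieAlgebra n g} {I J : Submodule ℂ g} (hI : L.IsIdeal I)
    (hJ : L.IsIdeal J) : L.IsIdeal (I ⊓ J) := fun v i hv ↦ ⟨hI v i hv.1, hJ v i hv.2⟩

lemma bracketSpan_restrict (L : NLieAlgebra n g) (hn : 0 < n) {I : Submodule ℂ g}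
    (hI : L.IsIdeal I) (hperf : L.bracketSpan I = I) : (L.restrict hn hI).bracketSpan ⊤ = ⊤ := by
  apply Submodule.map_injective_of_injective I.injective_subtype
  rw [Submodule.map_subtype_top]
  conv_rhs => rw [← hperf]
  rw [bracketSpan, bracketSpan, Submodule.map_span]
  congr 1
  ext z
  constructor
  · rintro ⟨_, ⟨v, -, rfl⟩, rfl⟩
    exact ⟨fun k ↦ v k, fun k ↦ (v k).2, rfl⟩
  · rintro ⟨v, hv, rfl⟩
    exact ⟨_, ⟨fun k ↦ ⟨v k, hv k⟩, fun _ ↦ trivial, rfl⟩, rfl⟩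

/-- The derived series of a finite-dimensional `n`-Lie algebra stabilizes at a perfect ideal. -/
lemma exists_bracketSpan_derivedSeries_eq [FiniteDimensional ℂ g] (L : NLieAlgebra n g)
    (hn : 0 < n) : ∃ r, L.IsIdeal (L.derivedSeries ⊤ r) ∧
      L.bracketSpan (L.derivedSeries ⊤ r) = L.derivedSeries ⊤ r := by
  have hid : ∀ r, L.IsIdeal (L.derivedSeries ⊤ r) := fun r ↦ by
    induction r with
    | zero => exact fun _ _ _ ↦ trivial
    | succ r ih => exact ih.bracketSpan
  have hanti : Antitone (L.derivedSeries ⊤) :=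
    antitone_nat_of_succ_le fun r ↦ (hid r).bracketSpan_le hn
  obtain ⟨r, hr⟩ := IsArtinian.monotone_stabilizes
    (⟨fun r ↦ OrderDual.toDual (L.derivedSeries ⊤ r), hanti⟩ : ℕ →o (Submodule ℂ g)ᵒᵈ)
  exact ⟨r, hid r, (hr (r + 1) (by lia)).symm⟩

end NLieAlgebra

/-! ### Orthogonality, isotropic ideals and the main argument -/

namespace MetricNLieAlgebra

variable {n : ℕ} {g : Type*} [AddCommGroup g] [Module ℂ g]

open NLieAlgebra

lemma B_ad (M : MetricNLieAlgebra n g) (v : Fin n → g) (i : Fin n) (x y : g) :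
    M.B (M.ad v i x) y = -M.B x (M.ad v i y) := by
  rw [ad_apply, M.invariant, M.symm, ad_apply]

lemma isIdeal_orthogonal {M : MetricNLieAlgebra n g} {I : Submodule ℂ g} (hI : M.IsIdeal I) :
    M.IsIdeal (M.orthogonal I) := isIdeal_of_ad fun v i x hx w hw ↦ by
  have := M.B_ad v i w x
  rw [hx _ (hI.ad_mem v i hw)] at this
  simpa using this

lemma bracket_mem_orthogonal_center (M : MetricNLieAlgebra n g) (hn : 0 < n) (v : Fin n → g) :
    M.bracket v ∈ M.orthogonal M.center := fun z hz ↦ by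
  have := M.B_ad v ⟨0, hn⟩ z (v ⟨0, hn⟩)
  rw [ad_apply, hz v] at this
  simpa using this

/-- An isotropic ideal orthogonal to the isomaximal center lies in the center. -/
lemma le_center_of_isotropic {M : MetricNLieAlgebra n g} (hiso : M.IsIsomaximal M.center)
    {I : Submodule ℂ g} (hI : M.IsIdeal I) (hII : ∀ x ∈ I, ∀ y ∈ I, M.B x y = 0)
    (hIZ : I ≤ M.orthogonal M.center) : I ≤ M.center := by
  have : M.IsIsotropicIdeal (I ⊔ M.center) := by
    refine ⟨hI.sup M.isIdeal_center, fun x hx y hy ↦ ?_⟩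
    obtain ⟨a, ha, c, hc, rfl⟩ := Submodule.mem_sup.mp hx
    obtain ⟨a', ha', c', hc', rfl⟩ := Submodule.mem_sup.mp hy
    have h1 : M.B a' a = 0 := hII _ ha' _ ha
    have h2 : M.B c' a = 0 := hIZ ha c' hc'
    have h3 : M.B a' c = 0 := by rw [M.symm]; exact hIZ ha' c hc
    have h4 : M.B c' c = 0 := hiso.prop.2 hc c' hc'
    simp [h1, h2, h3, h4]
  exact le_sup_left.trans (hiso.le_of_ge this le_sup_right)

lemma eq_bot_or_eq_top_of_isNondegenerate [FiniteDimensional ℂ g] {M : MetricNLieAlgebra n g}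
    (hM : M.IsIndecomposable) {J : Submodule ℂ g} (hJ : M.IsIdeal J) (hnd : M.IsNondegenerate J) :
    J = ⊥ ∨ J = ⊤ := by
  have hrefl : M.B.IsRefl := fun x y h ↦ by rw [M.symm, h]
  have hc : IsCompl J (M.orthogonal J) :=
    (LinearMap.BilinForm.isCompl_orthogonal_iff_disjoint hrefl).mpr (disjoint_iff.mpr hnd)
  by_cases hbot : J = ⊥
  · exact Or.inl hbot
  by_cases hbot' : M.orthogonal J = ⊥
  · exact Or.inr (by simpa [hbot'] using hc.sup_eq_top)
  refine (hM ⟨J, M.orthogonal J, hJ, isIdeal_orthogonal hJ, hnd, ?_, hbot, hbot', hc⟩).elim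
  -- The radical of J^⊥ is orthogonal to J + J^⊥ = g.
  refine (Submodule.eq_bot_iff _).mpr fun x hx ↦ M.nondegenerate x fun y ↦ ?_
  obtain ⟨a, ha, c, hc', rfl⟩ := Submodule.mem_sup.mp (hc.sup_eq_top ▸ Submodule.mem_top : y ∈ _)
  have h1 : M.B x a = 0 := by rw [M.symm]; exact hx.1 a ha
  have h2 : M.B x c = 0 := by rw [M.symm]; exact hx.2 c hc'
  rw [map_add, h1, h2, add_zero]

lemma eq_bot_of_perfect [FiniteDimensional ℂ g] {M : MetricNLieAlgebra n g} (hn : 2 ≤ n)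
    (hM : M.IsIndecomposable) (hcenter : M.center ≠ ⊥) (hiso : M.IsIsomaximal M.center)
    {P : Submodule ℂ g} (hP : M.IsIdeal P) (hperf : M.bracketSpan P = P) : P = ⊥ := by
  have hn' : 0 < n := by lia
  by_contra hbot
  have : Nontrivial P := Submodule.nontrivial_iff_ne_bot.mpr hbot
  have hPZ : P ≤ M.orthogonal M.center := by
    rw [← hperf, NLieAlgebra.bracketSpan, Submodule.span_le]
    rintro _ ⟨v, -, rfl⟩
    exact M.bracket_mem_orthogonal_center hn' v
  let L := M.restrict hn' hP
  let b : LinearMap.BilinForm ℂ P := M.B.restrict P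
  let N : Submodule ℂ P := M.center.comap P.subtype
  have hbr : ∀ v : Fin n → P, (L.bracket v : g) = M.bracket fun k ↦ (v k : g) := fun _ ↦ rfl
  have hadL : ∀ (v : Fin n → P) i (x : P), (L.ad v i x : g) = M.ad (fun k ↦ (v k : g)) i x :=
    fun v i x ↦ by rw [ad_apply, hbr, coe_update, ad_apply]
  -- Here `v` ranges over g, not just `P`: this makes D-stable subspaces ideals of g.
  have hinner : ∀ v i, (M.ad v i).restrict (fun _ hx ↦ hP.ad_mem v i hx) ∈
      L.skewDerivations b N := fun v i ↦ by
    refine ⟨fun x ↦ Subtype.ext ?_, fun x y ↦ M.B_ad v i x y, fun z hz ↦ Subtype.ext (hz v i)⟩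
    rw [AddSubmonoidClass.coe_finsetSum]
    simp only [hbr, coe_update]
    exact M.isDerivation_ad v i fun k ↦ (x k : g)
  have hideal : ∀ J : Submodule ℂ P, (∀ f ∈ L.skewDerivations b N, ∀ x ∈ J, f x ∈ J) →
      M.IsIdeal (J.map P.subtype) := fun J hJ ↦ isIdeal_of_ad fun v i ↦ by
    rintro _ ⟨x, hx, rfl⟩
    exact ⟨_, hJ _ (hinner v i) x hx, rfl⟩
  obtain ⟨J, hJD, hJ, hJN⟩ := exists_invariant_disjoint (L := L) (b := b) (N := N) hn
    (M.bracketSpan_restrict hn' hP hperf)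
    (fun v i x y ↦ by
      change M.B (L.ad v i x : g) y = -M.B x (L.ad v i y : g)
      rw [hadL, hadL, M.B_ad])
    (fun z hz v i ↦ Subtype.ext (by
      rw [hbr, coe_update]; exact hz _ i))
    (fun z hz v ↦ hPZ v.2 z hz)
    (fun I hI hII ↦ Submodule.map_le_iff_le_comap.mp <|
      le_center_of_isotropic hiso (hideal I hI)
        (by rintro _ ⟨x, hx, rfl⟩ _ ⟨y, hy, rfl⟩; exact hII x hx y hy)
        ((Submodule.map_subtype_le P I).trans hPZ))
  have hJZ : J.map P.subtype ⊓ M.center = ⊥ := by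
    rw [eq_bot_iff]
    rintro _ ⟨⟨x, hx, rfl⟩, hz⟩
    have : x = 0 := Submodule.disjoint_def.mp hJN x hx hz
    simp [this]
  have hJid := hideal J hJD
  have hJP : J.map P.subtype ≤ M.orthogonal M.center := (Submodule.map_subtype_le P J).trans hPZ
  have hnd : M.IsNondegenerate (J.map P.subtype) := by
    have hle := le_center_of_isotropic hiso (hJid.inf (isIdeal_orthogonal hJid))
      (fun x hx y hy ↦ hy.2 x hx.1) (inf_le_left.trans hJP)
    exact eq_bot_iff.mpr (hJZ ▸ le_inf inf_le_left hle)
  rcases eq_bot_or_eq_top_of_isNondegenerate hM hJid hnd with h | h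
  · exact hJ (Submodule.map_injective_of_injective P.injective_subtype
      (by rw [h, Submodule.map_bot]))
  · exact hcenter (by simpa [h] using hJZ)

end MetricNLieAlgebra

theorem corollary3p5 {n : ℕ} (hn : 2 ≤ n) {g : Type*} [AddCommGroup g] [Module ℂ g]
    [FiniteDimensional ℂ g] (M : MetricNLieAlgebra n g) (hM : M.IsIndecomposable)
    (hcenter : M.center ≠ ⊥) (hiso : M.IsIsomaximal M.center) :
    M.IsSolvable := by
  obtain ⟨r, hid, hr⟩ := M.exists_bracketSpan_derivedSeries_eq (by lia)
  exact ⟨fun _ _ _ ↦ trivial, r,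
    MetricNLieAlgebra.eq_bot_of_perfect hn hM hcenter hiso hid hr⟩
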